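/- Let $E\to M$ be a smooth real vector bundle of finite rank over a smooth manifold (finite-dimensional, Hausdorff, $\sigma$-compact, without boundary), with a smooth fibrewise non-degenerate symmetric bilinear form $\langle\,,\rangle$. Let $\mathcal A=\bigoplus_k\mathcal A^k$ be the graded algebra of functions on the minimal symplectic realization of $E$, with its canonical Poisson bracket $\{\,,\}$ of degree $-2$: it has local generators $q^i,\tau^a,p_i$ of degrees $0,1,2$ whose only non-zero brackets are $\{q^i,p_j\}=\delta^i_j$ and $\{\tau^a,\tau^b\}=g^{ab}$, where $g_{ab}=\langle e_a,e_b\rangle$ is constant in the local frame $(e_a)$ of $E$ used. Thus $\mathcal A^0=C^\infty(M)$, $\mathcal A^1=\Gamma(E)$ and $\{u,v\}=\langle u,v\rangle$ for sections $u,v$. Let $\Theta\in\mathcal A^3$ satisfy $\{\Theta,\Theta\}=0$, so that $(E,\langle\,,\rangle,\Theta)$ is a Courant algebroid, with Dorfman bracket $[u,v]=\{\{u,\Theta\},v\}$. A skew-symmetric covariant $k$-tensor $t$ on $E$ ($k\ge1$) is identified with the function $\tilde t\in\mathcal A^k$, locally a polynomial in the $\tau^a$ with coefficients in $C^\infty(M)$,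 such that $\{\dots\{\{u_1,\tilde t\},u_2\},\dots,u_k\}=t(u_1,\dots,u_k)$ for all sections $u_1,\dots,u_k$. For a vector bundle endomorphism $\mathcal N$ of $E$ that is skew-symmetric, i.e. $\langle\mathcal N u,v\rangle+\langle u,\mathcal N v\rangle=0$, let $\widetilde{\mathcal N}\in\mathcal A^2$ be the function of the tensor $(u,v)\mapsto\langle\mathcal N u,v\rangle$ (so $\{u,\widetilde{\mathcal N}\}=\mathcal N u$), and let $$(T_\Theta\mathcal N)(u,v)=[\mathcal N u,\mathcal N v]-\mathcal N\big([\mathcal N u,v]+[u,\mathcal N v]-\mathcal N[u,v]\big),\qquad u,v\in\Gamma(E).$$ **Theorem.** Let $\mathcal N$ be proportional to a generalized almost cps structure, i.e. $\mathcal N=\kappa J$ with $\kappa\in\mathbb R$ and $J$ a skew-symmetric vector bundle endomorphism of $E$ with $J^2=\varepsilon\,\mathrm{Id}_E$, $\varepsilon\in\{-1,0,1\}$ (equivalently, $\mathcal N$ is skew-symmetric and $\mathcal N^2=\lambda\,\mathrm{Id}_E$ for some $\lambda\in\mathbb R$). Then: (i) $T_\Theta\mathcal N$ is $C^\infty(M)$-linear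 in both arguments and skew-symmetric; moreover $(u,v,w)\mapsto\langle(T_\Theta\mathcal N)(u,v),w\rangle$ is a skew-symmetric covariant $3$-tensor on $E$, and so defines an element $\widetilde{T_\Theta\mathcal N}\in\mathcal A^3$. (ii) For all sections $u,v$ of $E$, $(T_\Theta\mathcal N)(u,v)=\{\{u,\widetilde{T_\Theta\mathcal N}\},v\}$. (iii) If $\mathcal N^2=\lambda\,\mathrm{Id}_E$ with $\lambda\in\mathbb R$, then $$\widetilde{T_\Theta\mathcal N}=-\tfrac12\big(\{\{\widetilde{\mathcal N},\Theta\},\widetilde{\mathcal N}\}+\lambda\,\Theta\big).$$ -/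

import Mathlib

open scoped Manifold ContDiff

/-! ## The graded Poisson algebra of a metric module

Let `E → M` be a vector bundle with a nondegenerate fibrewise symmetric bilinear form `⟨ , ⟩`, with
functions `R = C^∞(M)` and sections `𝓔 = Γ(E)`.  The algebra `𝒜` of functions on the minimal
symplectic realization of `E` has local generators `q^i, τ^a, p_i` of degrees `0, 1, 2` with
`{q^i, p_j} = δ^i_j` and `{τ^a, τ^b} = g^{ab}`.  A function `F` of degree `k` is determined by its
iterated brackets with the elements of `𝒜⁰ = C^∞(M)` and `𝒜¹ = Γ(E)`,

  `F [e₁, …, e_m] [f₁, …, f_n] = {…{{…{{F, e₁}, e₂}…, e_m}, f₁}…, f_n} ∈ C^∞(M)`,  `m + 2n = k`,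

and the families of maps that arise in this way are exactly those of the predicate `IsFunction`
below (Roytenberg's description of the cochains of a Courant-Dorfman algebra).  This is how `𝒜` is
built here.  Conventions: the Poisson bracket has degree `-2`, `{F, G} = -(-1)^{|F||G|} {G, F}`,
`{F, {G, H}} = {{F, G}, H} + (-1)^{|F||G|} {G, {F, H}}`, `{u, v} = ⟨u, v⟩`. -/

namespace MinimalRealization

section Algebra

/-- Families of maps of (lists of) sections and functions. -/
abbrev Cochain (R 𝓔 : Type*) := List 𝓔 → List R → R

variable {R 𝓔 : Type*} [CommRing R] [Algebra ℝ R] [AddCommGroup 𝓔] [Module ℝ 𝓔] [Module R 𝓔]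

/-- `F` is (the family of iterated brackets of) a function of degree `k` on the minimal symplectic
realization; `p` is the pairing `⟨ , ⟩` of sections. -/
structure IsFunction (p : 𝓔 → 𝓔 → R) (k : ℕ) (F : Cochain R 𝓔) : Prop where
  /-- only words of weight `k` occur (sections have weight `1`, functions have weight `2`) -/
  support : ∀ es fs, es.length + 2 * fs.length ≠ k → F es fs = 0
  /-- `ℝ`-linearity in every section -/
  add_section : ∀ l r u v fs, F (l ++ (u + v) :: r) fs = F (l ++ u :: r) fs + F (l ++ v :: r) fs
  smul_section : ∀ l r (a : ℝ) u fs, F (l ++ (a • u) :: r) fs = a • F (l ++ u :: r) fs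
  /-- `{G, f u} = f {G, u}` for `G ∈ 𝒜¹`: linearity over the functions in the last section -/
  smul_last : ∀ l (f : R) u fs, F (l ++ [f • u]) fs = f * F (l ++ [u]) fs
  /-- `{{G, u}, v} + {{G, v}, u} = {G, ⟨u, v⟩}` -/
  swap : ∀ l r u v fs,
    F (l ++ u :: v :: r) fs + F (l ++ v :: u :: r) fs = F (l ++ r) (p u v :: fs)
  /-- `{{G, f}, h} = {{G, h}, f}` -/
  perm : ∀ es fs fs', fs.Perm fs' → F es fs = F es fs'
  /-- `ℝ`-linear derivation in every function -/
  add_fun : ∀ es f h fs, F es ((f + h) :: fs) = F es (f :: fs) + F es (h :: fs)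
  smul_fun : ∀ es (a : ℝ) f fs, F es ((a • f) :: fs) = a • F es (f :: fs)
  leibniz : ∀ es f h fs, F es ((f * h) :: fs) = f * F es (h :: fs) + h * F es (f :: fs)

/-- The real vector space `𝒜ᵏ`. -/
def functions (p : 𝓔 → 𝓔 → R) (k : ℕ) : Submodule ℝ (Cochain R 𝓔) where
  carrier := {F | IsFunction p k F}
  zero_mem' := by constructor <;> simp
  add_mem' := by
    intro F G hF hG
    constructor
    · intro es fs h; simp [hF.support es fs h, hG.support es fs h]
    · intro l r u v fs
      simp only [Pi.add_apply, hF.add_section, hG.add_section]; ring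
    · intro l r a u fs
      simp only [Pi.add_apply, hF.smul_section, hG.smul_section, smul_add]
    · intro l f u fs
      simp only [Pi.add_apply, hF.smul_last, hG.smul_last]; ring
    · intro l r u v fs
      simp only [Pi.add_apply, ← hF.swap, ← hG.swap]; ring
    · intro es fs fs' h
      simp only [Pi.add_apply, hF.perm es fs fs' h, hG.perm es fs fs' h]
    · intro es f h fs
      simp only [Pi.add_apply, hF.add_fun, hG.add_fun]; ring
    · intro es a f fs
      simp only [Pi.add_apply, hF.smul_fun, hG.smul_fun, smul_add]
    · intro es f h fs
      simp only [Pi.add_apply, hF.leibniz, hG.leibniz]; ring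
  smul_mem' := by
    intro c F hF
    constructor
    · intro es fs h; simp [hF.support es fs h]
    · intro l r u v fs
      simp only [Pi.smul_apply, hF.add_section, smul_add]
    · intro l r a u fs
      simp only [Pi.smul_apply, hF.smul_section, smul_comm c a]
    · intro l f u fs
      simp only [Pi.smul_apply, hF.smul_last, mul_smul_comm]
    · intro l r u v fs
      simp only [Pi.smul_apply, ← hF.swap, smul_add]
    · intro es fs fs' h
      simp only [Pi.smul_apply, hF.perm es fs fs' h]
    · intro es f h fs
      simp only [Pi.smul_apply, hF.add_fun, smul_add]
    · intro es a f fs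
      simp only [Pi.smul_apply, hF.smul_fun, smul_comm c a]
    · intro es f h fs
      simp only [Pi.smul_apply, hF.leibniz, smul_add, mul_smul_comm]

/-- The section `u` of `E` as the element `v ↦ {u, v} = ⟨u, v⟩` of `𝒜¹`. -/
def ofSection (p : 𝓔 → 𝓔 → R) (u : 𝓔) : Cochain R 𝓔
  | [v], [] => p u v
  | _, _ => 0

open Classical in
/-- The identification `𝒜¹ ≃ Γ(E)`: the section `u` such that `{F, v} = ⟨u, v⟩` for all `v`. -/
noncomputable def toSection (p : 𝓔 → 𝓔 → R) (F : Cochain R 𝓔) : 𝓔 :=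
  if h : ∃ u, ∀ v, F [v] [] = p u v then h.choose else 0

/-- `{F, u}` for a section `u`. -/
def brSection (F : Cochain R 𝓔) (u : 𝓔) : Cochain R 𝓔 := fun es fs => F (u :: es) fs

/-- `{F, f}` for a function `f`; here `{{F, f}, u} = {{F, u}, f}` since `{u, f} = 0`. -/
def brFun (F : Cochain R 𝓔) (f : R) : Cochain R 𝓔 := fun es fs => F es (f :: fs)

/-- The canonical Poisson bracket `{F, G} ∈ 𝒜^{k+l-2}` of `F ∈ 𝒜ᵏ` and `G ∈ 𝒜ˡ`.  If one of the
degrees is `0` or `1` it is given by graded skew-symmetry and the iterated brackets of the other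
entry; in general by the Jacobi identity
`{{F, G}, x} = {F, {G, x}} + (-1)^{|G||x|} {{F, x}, G}` for `x` a section or a function. -/
noncomputable def bracket (p : 𝓔 → 𝓔 → R) :
    ℕ → ℕ → Cochain R 𝓔 → Cochain R 𝓔 → List 𝓔 → List R → R
  | 0, _, F, G, es, fs => -brFun G (F [] []) es fs
  | _ + 1, 0, F, G, es, fs => brFun F (G [] []) es fs
  | 1, l + 1, F, G, es, fs => (-1) ^ l * brSection G (toSection p F) es fs
  | _ + 2, 1, F, G, es, fs => brSection F (toSection p G) es fs
  | k + 2, l + 2, F, G, u :: es, fs =>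
      bracket p (k + 2) (l + 1) F (brSection G u) es fs
        + (-1) ^ (l + 2) * bracket p (k + 1) (l + 2) (brSection F u) G es fs
  | k + 2, l + 2, F, G, [], f :: fs =>
      bracket p (k + 2) l F (brFun G f) [] fs + bracket p k (l + 2) (brFun F f) G [] fs
  | _ + 2, _ + 2, _, _, [], [] => 0
termination_by k l => k + l

/-- A Courant algebroid structure: `Θ ∈ 𝒜³` with `{Θ, Θ} = 0`. -/
structure IsCourantStructure (p : 𝓔 → 𝓔 → R) (Θ : Cochain R 𝓔) : Prop where
  mem : Θ ∈ functions p 3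
  bracket_self : bracket p 3 3 Θ Θ = 0

/-- The Dorfman bracket `[u, v] = {{u, Θ}, v}`, an element of `𝒜¹ = Γ(E)`. -/
noncomputable def dorfman (p : 𝓔 → 𝓔 → R) (Θ : Cochain R 𝓔) (u v : 𝓔) : 𝓔 :=
  toSection p (bracket p 2 1 (bracket p 1 3 (ofSection p u) Θ) (ofSection p v))

/-- `[u, v]_N = [N u, v] + [u, N v] - N [u, v]`. -/
noncomputable def deformedDorfman (p : 𝓔 → 𝓔 → R) (Θ : Cochain R 𝓔) (N : 𝓔 → 𝓔) (u v : 𝓔) : 𝓔 :=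
  dorfman p Θ (N u) v + dorfman p Θ u (N v) - N (dorfman p Θ u v)

/-- The Nijenhuis torsion `(T_Θ N)(u, v) = [N u, N v] - N [u, v]_N`. -/
noncomputable def torsion (p : 𝓔 → 𝓔 → R) (Θ : Cochain R 𝓔) (N : 𝓔 → 𝓔) (u v : 𝓔) : 𝓔 :=
  dorfman p Θ (N u) (N v) - N (deformedDorfman p Θ N u v)

/-- The function `Ñ = ½ N^b_a g_{bc} τ^a τ^c` of a skew-symmetric endomorphism `N`, that is, the
element of `𝒜²` with `{u, Ñ} = N u`, i.e. `{{u, Ñ}, v} = ⟨N u, v⟩`.  Since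
`{u, Ñ} = -{Ñ, u}` (degrees `1` and `2`), its iterated brackets are
`{{Ñ, u}, v} = -⟨N u, v⟩` and `{Ñ, f} = 0`. -/
def ofEndo (p : 𝓔 → 𝓔 → R) (N : 𝓔 → 𝓔) : Cochain R 𝓔
  | [u, v], [] => -p (N u) v
  | _, _ => 0

/-- The function of the covariant 3-tensor `(u, v, w) ↦ ⟨t(u, v), w⟩`, for a skew-symmetric `t`:
the element `t̃` of `𝒜³` with `{{{u, t̃}, v}, w} = ⟨t(u, v), w⟩`.  Since `{u, t̃} = {t̃, u}`
(degrees `1` and `3`), its iterated brackets are `{{{t̃, u}, v}, w} = ⟨t(u, v), w⟩` and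
`{{t̃, u}, f} = 0`. -/
def ofTensor (p : 𝓔 → 𝓔 → R) (t : 𝓔 → 𝓔 → 𝓔) : Cochain R 𝓔
  | [u, v, w], [] => p (t u v) w
  | _, _ => 0

end Algebra

/-! ## Vector bundles with a fibrewise bilinear form -/

section Geometry

variable {B : Type*} [NormedAddCommGroup B] [NormedSpace ℝ B]
  {M : Type*} [TopologicalSpace M] [ChartedSpace B M]
  {F : Type*} [NormedAddCommGroup F] [NormedSpace ℝ F]
  {V : M → Type*} [TopologicalSpace (Bundle.TotalSpace F V)]
  [∀ x, TopologicalSpace (V x)] [∀ x, AddCommGroup (V x)] [∀ x, Module ℝ (V x)]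
  [FiberBundle F V] [VectorBundle ℝ F V]

/-- Smooth sections form a module over the smooth functions. -/
noncomputable instance sectionModule : Module C^∞⟮𝓘(ℝ, B), M; ℝ⟯ Cₛ^∞⟮𝓘(ℝ, B); F, V⟯ where
  smul f s := ⟨fun x => f x • s x, f.contMDiff.smul_section s.contMDiff⟩
  one_smul s := by ext x; exact one_smul ℝ (s x)
  mul_smul f h s := by ext x; exact mul_smul (f x) (h x) (s x)
  smul_zero f := by ext x; exact smul_zero (f x)
  smul_add f s t := by ext x; exact smul_add (f x) (s x) (t x)
  add_smul f h s := by ext x; exact add_smul (f x) (h x) (s x)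
  zero_smul s := by ext x; exact zero_smul ℝ (s x)

variable (B F V) [∀ x, IsTopologicalAddGroup (V x)] [∀ x, ContinuousSMul ℝ (V x)]

/-- A smooth fibrewise nondegenerate symmetric bilinear form on the bundle `V`. -/
structure FiberMetric where
  /-- the bilinear form on each fibre -/
  form (x : M) : V x →L[ℝ] V x →L[ℝ] ℝ
  smooth : ContMDiff 𝓘(ℝ, B) (𝓘(ℝ, B).prod 𝓘(ℝ, F →L[ℝ] F →L[ℝ] ℝ)) ∞
    (fun x => Bundle.TotalSpace.mk' (F →L[ℝ] F →L[ℝ] ℝ)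
      (E := fun x => V x →L[ℝ] V x →L[ℝ] ℝ) x (form x))
  symm : ∀ x (v w : V x), form x v w = form x w v
  nondegenerate : ∀ x (v : V x), (∀ w, form x v w = 0) → v = 0

/-- A (smooth) vector bundle endomorphism of `V`, over the identity of the base. -/
structure BundleEndo where
  /-- the endomorphism of each fibre -/
  map (x : M) : V x →L[ℝ] V x
  smooth : ContMDiff 𝓘(ℝ, B) (𝓘(ℝ, B).prod 𝓘(ℝ, F →L[ℝ] F)) ∞
    (fun x => Bundle.TotalSpace.mk' (F →L[ℝ] F) (E := fun x => V x →L[ℝ] V x) x (map x))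

variable {B F V}

/-- The smooth function `⟨u, v⟩` of two sections. -/
noncomputable def FiberMetric.pairing (g : FiberMetric B F V)
    (u v : Cₛ^∞⟮𝓘(ℝ, B); F, V⟯) : C^∞⟮𝓘(ℝ, B), M; ℝ⟯ :=
  ⟨fun x => g.form x (u x) (v x), fun x => by
    have h : ContMDiffAt 𝓘(ℝ, B) (𝓘(ℝ, B).prod 𝓘(ℝ, ℝ)) ∞
        (fun m => Bundle.TotalSpace.mk' ℝ (E := Bundle.Trivial M ℝ) m
          (g.form m (u m) (v m))) x := by
      apply ContMDiffAt.clm_bundle_apply₂ (F₁ := F) (F₂ := F)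
      · exact g.smooth x
      · exact u.contMDiff x
      · exact v.contMDiff x
    simp only [Bundle.contMDiffAt_totalSpace] at h
    exact h.2⟩

/-- The action of a bundle endomorphism on sections. -/
noncomputable def BundleEndo.onSections (N : BundleEndo B F V)
    (u : Cₛ^∞⟮𝓘(ℝ, B); F, V⟯) : Cₛ^∞⟮𝓘(ℝ, B); F, V⟯ :=
  ⟨fun x => N.map x (u x), N.smooth.clm_bundle_apply u.contMDiff⟩

/-- `⟨N u, v⟩ + ⟨u, N v⟩ = 0`. -/
def BundleEndo.IsSkew (g : FiberMetric B F V) (N : BundleEndo B F V) : Prop :=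
  ∀ x (u v : V x), g.form x (N.map x u) v + g.form x u (N.map x v) = 0

/-- `N² = c Id`. -/
def BundleEndo.SquareEq (N : BundleEndo B F V) (c : ℝ) : Prop :=
  ∀ x (u : V x), N.map x (N.map x u) = c • u

/-- Generalized almost cps (complex, paracomplex or subtangent) structures. -/
def BundleEndo.IsGeneralizedAlmostCPS (g : FiberMetric B F V) (J : BundleEndo B F V) : Prop :=
  J.IsSkew g ∧ ∃ ε : ℝ, (ε = -1 ∨ ε = 1 ∨ ε = 0) ∧ J.SquareEq ε

/-- `N = κ J` for a real number `κ` and a generalized almost cps structure `J`. -/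
def BundleEndo.IsProportionalToAlmostCPS (g : FiberMetric B F V) (N : BundleEndo B F V) : Prop :=
  ∃ (κ : ℝ) (J : BundleEndo B F V), J.IsGeneralizedAlmostCPS g ∧ ∀ x, N.map x = κ • J.map x

end Geometry

end MinimalRealization

/-! An element of degree 3 is determined by its values on the words `[u, v, w] []` and `[u] [f]`,
the second being the anchor part; every other word has the wrong weight. So each claim becomes an
identity between such values. Nondegeneracy identifies sections with functionals linear over the
functions (`FiberMetric.isPerfectMetric_pairing`), hence `⟨[u, v], w⟩ = Θ [u, v, w] []`
(`IsFunction.pairing_dorfman`).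

For skew `N` with `N² = c` this gives `⟨T(u, v), w⟩ = P + c Θ(u, v, w)`, where `P` sums `Θ` with `N`
inserted in two of the three slots (`pairing_torsion`). Exchanging neighbouring slots of `Θ` costs
anchor terms. They cancel, because `⟨N u, v⟩ + ⟨u, N v⟩ = 0` and `⟨N u, N v⟩ = -c ⟨u, v⟩` with `c` a
real constant, which the anchor does not differentiate. Thus the form is totally skew, and linearity
over the functions in its last slot spreads to the others.

Bracketing with `Ñ` inserts `N` into each slot in turn, up to sign. Twice gives `{{Ñ, Θ}, Ñ} = -(2 P
+ 3 c Θ)` on triples of sections and `-c Θ` on the anchor part. Adding `c Θ` leaves `-2 T̃` and `0`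
respectively (`ofTensor_torsion_eq`). -/

namespace MinimalRealization

/-! ### Weights of cochains and of their brackets. -/

section PoissonAlgebra

variable {R 𝓔 : Type*} [CommRing R]

theorem ofTensor_support (p : 𝓔 → 𝓔 → R) (t : 𝓔 → 𝓔 → 𝓔) (es : List 𝓔) (fs : List R)
    (h : es.length + 2 * fs.length ≠ 3) : ofTensor p t es fs = 0 := by
  unfold ofTensor
  split
  · simp at h
  · rfl

theorem ofEndo_support (p : 𝓔 → 𝓔 → R) (N : 𝓔 → 𝓔) (es : List 𝓔) (fs : List R)
    (h : es.length + 2 * fs.length ≠ 2) : ofEndo p N es fs = 0 := by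
  unfold ofEndo
  split
  · simp at h
  · rfl

variable [AddCommGroup 𝓔]

/-- The bracket of functions of degrees `k` and `l` has degree `k + l - 2`. -/
theorem bracket_eq_zero_of_weight_ne (p : 𝓔 → 𝓔 → R) (k l : ℕ) (F G : Cochain R 𝓔)
    (hF : ∀ es fs, es.length + 2 * fs.length ≠ k → F es fs = 0)
    (hG : ∀ es fs, es.length + 2 * fs.length ≠ l → G es fs = 0)
    (es : List 𝓔) (fs : List R) (h : es.length + 2 * fs.length + 2 ≠ k + l) :
    bracket p k l F G es fs = 0 := by
  -- `k + l` is the measure on which the recursion of `bracket` terminates; the cochains vary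
  -- because each step contracts one of them with a letter of the word.
  induction hn : k + l using Nat.strong_induction_on generalizing k l F G es fs with
  | _ n ih =>
  match k, l, es, fs with
  | 0, l, es, fs =>
    rw [bracket, brFun, hG _ _ (by simp; omega), neg_zero]
  | k + 1, 0, es, fs =>
    rw [bracket, brFun, hF _ _ (by simp; omega)]
  | 1, l + 1, es, fs =>
    rw [bracket, brSection, hG _ _ (by simp; omega), mul_zero]
  | k + 2, 1, es, fs =>
    rw [bracket, brSection, hF _ _ (by simp; omega)]
  | k + 2, l + 2, u :: es, fs =>
    simp only [List.length_cons] at h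
    rw [bracket,
      ih _ (by omega) (k + 2) (l + 1) F (brSection G u) hF
        (fun es fs h' => hG _ _ (by simp; omega)) es fs (by omega) rfl,
      ih _ (by omega) (k + 1) (l + 2) (brSection F u) G
        (fun es fs h' => hF _ _ (by simp; omega)) hG es fs (by omega) rfl]
    simp
  | k + 2, l + 2, [], f :: fs =>
    simp only [List.length_cons, List.length_nil] at h
    rw [bracket,
      ih _ (by omega) (k + 2) l F (brFun G f) hF
        (fun es fs h' => hG _ _ (by simp; omega)) [] fs (by simp; omega) rfl,
      ih _ (by omega) k (l + 2) (brFun F f) G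
        (fun es fs h' => hF _ _ (by simp; omega)) hG [] fs (by simp; omega) rfl]
    simp
  | k + 2, l + 2, [], [] => rw [bracket]

/-! ### Perfect pairings. -/

variable [Module R 𝓔]

/-- A symmetric `R`-bilinear form that identifies a module with its dual. -/
structure IsPerfectMetric (p : 𝓔 → 𝓔 → R) : Prop where
  add_left : ∀ u v w, p (u + v) w = p u w + p v w
  smul_left : ∀ (f : R) u v, p (f • u) v = f * p u v
  symm : ∀ u v, p u v = p v u
  separating : ∀ u v, (∀ w, p u w = p v w) → u = v
  represents : ∀ φ : 𝓔 →ₗ[R] R, ∃ u, ∀ w, φ w = p u w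

namespace IsPerfectMetric

variable {p : 𝓔 → 𝓔 → R} (hp : IsPerfectMetric p)
include hp

theorem add_right (u v w : 𝓔) : p u (v + w) = p u v + p u w := by
  rw [hp.symm, hp.add_left, hp.symm v, hp.symm w]

theorem smul_right (f : R) (u v : 𝓔) : p u (f • v) = f * p u v := by
  rw [hp.symm, hp.smul_left, hp.symm v]

theorem neg_left (u v : 𝓔) : p (-u) v = -p u v := by
  rw [← neg_one_smul R u, hp.smul_left]; ring

theorem sub_left (u v w : 𝓔) : p (u - v) w = p u w - p v w := by
  rw [sub_eq_add_neg, hp.add_left, hp.neg_left, sub_eq_add_neg]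

/-- Separation makes the representing section unique, so the choice inside `toSection` is harmless
and any known representative may replace it. -/
theorem toSection_eq {F : Cochain R 𝓔} {s : 𝓔} (h : ∀ v, F [v] [] = p s v) :
    toSection p F = s := by
  have hex : ∃ u, ∀ v, F [v] [] = p u v := ⟨s, h⟩
  rw [toSection, dif_pos hex]
  exact hp.separating _ _ fun w => by rw [← hex.choose_spec w, h w]

theorem toSection_ofSection (u : 𝓔) : toSection p (ofSection p u) = u :=
  hp.toSection_eq fun _ => rfl

variable [Algebra ℝ R] [Module ℝ 𝓔] [IsScalarTower ℝ R 𝓔]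

theorem real_smul_left (a : ℝ) (u v : 𝓔) : p (a • u) v = a • p u v := by
  rw [← algebraMap_smul R a u, hp.smul_left, Algebra.smul_def]

theorem real_smul_right (a : ℝ) (u v : 𝓔) : p u (a • v) = a • p u v := by
  rw [hp.symm, hp.real_smul_left, hp.symm v]

end IsPerfectMetric

/-! ### Brackets with `Ñ` and with sections. -/

theorem toSection_ofEndo {p : 𝓔 → 𝓔 → R} (hp : IsPerfectMetric p) (N : 𝓔 →ₗ[R] 𝓔)
    (u : 𝓔) :
    toSection p (brSection (ofEndo p N) u) = -N u :=
  hp.toSection_eq fun v => (hp.neg_left _ v).symm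

/-- `{Φ, Ñ}` for a function `Φ` of degree `3` whose associated bracket of sections is `D`. -/
theorem bracket_ofEndo_right_apply {p : 𝓔 → 𝓔 → R} {N : 𝓔 →ₗ[R] 𝓔}
    (hp : IsPerfectMetric p) {Φ : Cochain R 𝓔} {D : 𝓔 → 𝓔 → 𝓔}
    (hD : ∀ u v w, Φ [u, v, w] [] = p (D u v) w)
    (hN : ∀ u v, p (N u) v = -p u (N v)) (u v w : 𝓔) :
    bracket p 3 2 Φ (ofEndo p N) [u, v, w] [] =
      Φ [-N u, v, w] [] + Φ [u, -N v, w] [] - Φ [u, v, N w] [] := by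
  -- After two contractions `Φ` has degree 1, where `bracket` passes through `toSection`; `D`
  -- supplies the representative. Nothing else is assumed of `Φ`, so the signs in `-N u` and `-N v`
  -- stay inside its arguments.
  have hs : toSection p (brSection (brSection Φ u) v) = D u v :=
    hp.toSection_eq fun w => hD u v w
  rw [bracket, bracket, bracket, bracket, bracket, toSection_ofEndo hp N, toSection_ofEndo hp N, hs]
  simp only [brSection, ofEndo, hN, hD]
  ring

theorem bracket_ofEndo_right_anchor {p : 𝓔 → 𝓔 → R} {N : 𝓔 →ₗ[R] 𝓔}
    (hp : IsPerfectMetric p) {Φ : Cochain R 𝓔}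
    (hΦ : ∀ u, Φ [u] [0] = 0) (u : 𝓔) (f : R) :
    bracket p 3 2 Φ (ofEndo p N) [u] [f] = Φ [-N u] [f] := by
  rw [bracket, bracket, bracket, bracket, bracket, toSection_ofEndo hp N]
  simp only [brSection, brFun, ofEndo, hΦ]
  ring

theorem bracket_ofSection_left {p : 𝓔 → 𝓔 → R} (hp : IsPerfectMetric p) (u : 𝓔)
    (G : Cochain R 𝓔) : bracket p 1 3 (ofSection p u) G = brSection G u := by
  funext es fs
  rw [bracket, hp.toSection_ofSection]
  norm_num

theorem bracket_ofSection_right {p : 𝓔 → 𝓔 → R} (hp : IsPerfectMetric p) (v : 𝓔)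
    (F : Cochain R 𝓔) : bracket p 2 1 F (ofSection p v) = brSection F v := by
  funext es fs
  rw [bracket, hp.toSection_ofSection]

variable [Algebra ℝ R] [Module ℝ 𝓔]

/-! ### The axioms of a function, specialized to degree 3. -/

namespace IsFunction

variable {p : 𝓔 → 𝓔 → R} {Θ : Cochain R 𝓔} (hΘ : IsFunction p 3 Θ)
include hΘ

theorem add₃ (u v w w' : 𝓔) : Θ [u, v, w + w'] [] = Θ [u, v, w] [] + Θ [u, v, w'] [] :=
  hΘ.add_section [u, v] [] w w' []

theorem smul₁ (a : ℝ) (u v w : 𝓔) : Θ [a • u, v, w] [] = a • Θ [u, v, w] [] :=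
  hΘ.smul_section [] [v, w] a u []

theorem smul₂ (a : ℝ) (u v w : 𝓔) : Θ [u, a • v, w] [] = a • Θ [u, v, w] [] :=
  hΘ.smul_section [u] [w] a v []

theorem smul₃ (a : ℝ) (u v w : 𝓔) : Θ [u, v, a • w] [] = a • Θ [u, v, w] [] :=
  hΘ.smul_section [u, v] [] a w []

theorem neg₁ (u v w : 𝓔) : Θ [-u, v, w] [] = -Θ [u, v, w] [] := by
  rw [← neg_one_smul ℝ u, hΘ.smul₁, neg_one_smul]

theorem neg₂ (u v w : 𝓔) : Θ [u, -v, w] [] = -Θ [u, v, w] [] := by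
  rw [← neg_one_smul ℝ v, hΘ.smul₂, neg_one_smul]

theorem smul_last₃ (f : R) (u v w : 𝓔) : Θ [u, v, f • w] [] = f * Θ [u, v, w] [] :=
  hΘ.smul_last [u, v] f w []

theorem swap₁₂ (u v w : 𝓔) : Θ [u, v, w] [] + Θ [v, u, w] [] = Θ [w] [p u v] :=
  hΘ.swap [] [w] u v []

theorem swap₂₃ (u v w : 𝓔) : Θ [u, v, w] [] + Θ [u, w, v] [] = Θ [u] [p v w] :=
  hΘ.swap [u] [] v w []

theorem anchor_neg (u : 𝓔) (f : R) : Θ [-u] [f] = -Θ [u] [f] := by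
  rw [← neg_one_smul ℝ u]
  simpa using hΘ.smul_section [] [] (-1) u [f]

theorem anchor_smul (a : ℝ) (u : 𝓔) (f : R) : Θ [a • u] [f] = a • Θ [u] [f] :=
  hΘ.smul_section [] [] a u [f]

theorem anchor_smul_right (a : ℝ) (u : 𝓔) (f : R) : Θ [u] [a • f] = a • Θ [u] [f] :=
  hΘ.smul_fun [u] a f []

theorem anchor_zero_right (u : 𝓔) : Θ [u] [0] = 0 := by
  simpa using hΘ.smul_fun [u] 0 0 []

theorem anchor_add_right (u : 𝓔) (f h : R) : Θ [u] [f + h] = Θ [u] [f] + Θ [u] [h] :=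
  hΘ.add_fun [u] f h []

/-- The Dorfman bracket is characterized by `⟨[u, v], w⟩ = {{{u, Θ}, v}, w}`. -/
theorem pairing_dorfman (hp : IsPerfectMetric p) (u v w : 𝓔) :
    p (dorfman p Θ u v) w = Θ [u, v, w] [] := by
  -- Linearity over the functions holds in the last slot, and that slot alone is needed to represent
  -- the functional by a section.
  obtain ⟨s, hs⟩ := hp.represents
    { toFun := fun w => Θ [u, v, w] []
      map_add' := hΘ.add₃ u v
      map_smul' := fun f w => hΘ.smul_last₃ f u v w }
  have : dorfman p Θ u v = s := by
    rw [dorfman, bracket_ofSection_left hp, bracket_ofSection_right hp]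
    exact hp.toSection_eq hs
  rw [this]
  exact (hs w).symm

end IsFunction

/-! ### The torsion as a skew-symmetric tensor. -/

section Skew

variable {p : 𝓔 → 𝓔 → R} {Θ : Cochain R 𝓔} {N : 𝓔 →ₗ[R] 𝓔}

/-- The Jacobi recursion places `N` in the first two slots directly. The last term is `-⟨N [u, v],
w⟩`, which skewness turns into `Θ [u, v, N w] []`. -/
theorem bracket_ofEndo_apply (hp : IsPerfectMetric p) (hΘ : IsFunction p 3 Θ)
    (hN : ∀ u v, p (N u) v = -p u (N v)) (u v w : 𝓔) :
    bracket p 2 3 (ofEndo p N) Θ [u, v, w] [] =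
      Θ [N u, v, w] [] + Θ [u, N v, w] [] + Θ [u, v, N w] [] := by
  have hs : toSection p (brSection (brSection Θ u) v) = dorfman p Θ u v :=
    hp.toSection_eq fun w => (hΘ.pairing_dorfman hp u v w).symm
  rw [bracket, bracket, bracket, bracket, bracket, toSection_ofEndo hp N, toSection_ofEndo hp N, hs]
  simp only [brSection, ofEndo, hΘ.neg₁, hΘ.neg₂, hN, hΘ.pairing_dorfman hp]
  ring

theorem bracket_ofEndo_anchor (hp : IsPerfectMetric p) (hΘ : IsFunction p 3 Θ) (u : 𝓔) (f : R) :
    bracket p 2 3 (ofEndo p N) Θ [u] [f] = Θ [N u] [f] := by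
  rw [bracket, bracket, bracket, bracket, bracket, toSection_ofEndo hp N]
  simp only [brSection, brFun, ofEndo, hΘ.anchor_neg, hΘ.anchor_zero_right]
  ring

variable [IsScalarTower ℝ R 𝓔] {c : ℝ}

/-- Each outer `N` moves to `w` by skewness, while `N²` acts as `c`; the result treats the three
slots alike. -/
theorem pairing_torsion (hp : IsPerfectMetric p) (hΘ : IsFunction p 3 Θ)
    (hN : ∀ u v, p (N u) v = -p u (N v)) (hc : ∀ u, N (N u) = c • u) (u v w : 𝓔) :
    p (torsion p Θ N u v) w =
      Θ [N u, N v, w] [] + Θ [N u, v, N w] [] + Θ [u, N v, N w] [] + c • Θ [u, v, w] [] := by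
  simp only [torsion, deformedDorfman, map_add, map_sub, hc, hp.sub_left, hp.add_left, hN,
    hp.real_smul_left, hΘ.pairing_dorfman hp]
  ring

theorem pairing_torsion_swap_left (hp : IsPerfectMetric p) (hΘ : IsFunction p 3 Θ)
    (hN : ∀ u v, p (N u) v = -p u (N v)) (hc : ∀ u, N (N u) = c • u) (u v w : 𝓔) :
    p (torsion p Θ N u v) w = -p (torsion p Θ N v u) w := by
  simp only [pairing_torsion hp hΘ hN hc]
  have h₁ := hΘ.swap₁₂ (N u) (N v) w
  have h₂ := hΘ.swap₁₂ (N u) v (N w)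
  have h₃ := hΘ.swap₁₂ u (N v) (N w)
  have h₄ := congrArg (c • ·) (hΘ.swap₁₂ u v w)
  -- The anchor terms of `h₂` and `h₃` add up to the anchor of `N w` on `⟨N u, v⟩ + ⟨u, N v⟩ = 0`.
  have h₅ := hΘ.anchor_add_right (N w) (p (N u) v) (p u (N v))
  rw [hN, neg_add_cancel, hΘ.anchor_zero_right, ← hN] at h₅
  -- Since `⟨N u, N v⟩ = -c ⟨u, v⟩` and `c` is real, this anchor term cancels the one in `h₄`.
  rw [hN, hc, hp.real_smul_right, ← neg_smul, hΘ.anchor_smul_right, neg_smul] at h₁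
  simp only [smul_add] at h₄
  linear_combination h₁ + h₂ + h₃ + h₄ - h₅

/-- The same cancellation, now with the anchors of `u` and `N u`. -/
theorem pairing_torsion_swap_right (hp : IsPerfectMetric p) (hΘ : IsFunction p 3 Θ)
    (hN : ∀ u v, p (N u) v = -p u (N v)) (hc : ∀ u, N (N u) = c • u) (u v w : 𝓔) :
    p (torsion p Θ N u v) w = -p (torsion p Θ N u w) v := by
  simp only [pairing_torsion hp hΘ hN hc]
  have h₁ := hΘ.swap₂₃ u (N v) (N w)
  have h₂ := hΘ.swap₂₃ (N u) (N v) w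
  have h₃ := hΘ.swap₂₃ (N u) v (N w)
  have h₄ := congrArg (c • ·) (hΘ.swap₂₃ u v w)
  have h₅ := hΘ.anchor_add_right (N u) (p (N v) w) (p v (N w))
  rw [hN, neg_add_cancel, hΘ.anchor_zero_right, ← hN] at h₅
  rw [hN, hc, hp.real_smul_right, ← neg_smul, hΘ.anchor_smul_right, neg_smul] at h₁
  simp only [smul_add] at h₄
  linear_combination h₁ + h₂ + h₃ + h₄ - h₅

theorem torsion_swap (hp : IsPerfectMetric p) (hΘ : IsFunction p 3 Θ)
    (hN : ∀ u v, p (N u) v = -p u (N v)) (hc : ∀ u, N (N u) = c • u) (u v : 𝓔) :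
    torsion p Θ N u v = -torsion p Θ N v u :=
  hp.separating _ _ fun w => by
    rw [hp.neg_left, pairing_torsion_swap_left hp hΘ hN hc]

/-- Skewness carries `v` into the second argument of `p`, where linearity is that of the metric;
`torsion_smul_right` works the same way. -/
theorem torsion_add_right (hp : IsPerfectMetric p) (hΘ : IsFunction p 3 Θ)
    (hN : ∀ u v, p (N u) v = -p u (N v)) (hc : ∀ u, N (N u) = c • u) (u v v' : 𝓔) :
    torsion p Θ N u (v + v') = torsion p Θ N u v + torsion p Θ N u v' :=
  hp.separating _ _ fun w => by
    rw [hp.add_left]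
    simp only [pairing_torsion_swap_right hp hΘ hN hc u _ w, hp.add_right, neg_add]

theorem torsion_smul_right (hp : IsPerfectMetric p) (hΘ : IsFunction p 3 Θ)
    (hN : ∀ u v, p (N u) v = -p u (N v)) (hc : ∀ u, N (N u) = c • u) (f : R) (u v : 𝓔) :
    torsion p Θ N u (f • v) = f • torsion p Θ N u v :=
  hp.separating _ _ fun w => by
    rw [hp.smul_left]
    simp only [pairing_torsion_swap_right hp hΘ hN hc u _ w, hp.smul_right, mul_neg]

theorem torsion_add_left (hp : IsPerfectMetric p) (hΘ : IsFunction p 3 Θ)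
    (hN : ∀ u v, p (N u) v = -p u (N v)) (hc : ∀ u, N (N u) = c • u) (u u' v : 𝓔) :
    torsion p Θ N (u + u') v = torsion p Θ N u v + torsion p Θ N u' v := by
  simp only [torsion_swap hp hΘ hN hc _ v, torsion_add_right hp hΘ hN hc, neg_add]

theorem torsion_smul_left (hp : IsPerfectMetric p) (hΘ : IsFunction p 3 Θ)
    (hN : ∀ u v, p (N u) v = -p u (N v)) (hc : ∀ u, N (N u) = c • u) (f : R) (u v : 𝓔) :
    torsion p Θ N (f • u) v = f • torsion p Θ N u v := by
  simp only [torsion_swap hp hΘ hN hc _ v, torsion_smul_right hp hΘ hN hc, smul_neg]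

/-- The torsion of a skew-symmetric `N` with `N² = c`, as a bilinear map over the functions. -/
noncomputable def torsionₗ (hp : IsPerfectMetric p) (hΘ : IsFunction p 3 Θ)
    (hN : ∀ u v, p (N u) v = -p u (N v)) (hc : ∀ u, N (N u) = c • u) : 𝓔 →ₗ[R] 𝓔 →ₗ[R] 𝓔 :=
  .mk₂ R (torsion p Θ N) (torsion_add_left hp hΘ hN hc) (torsion_smul_left hp hΘ hN hc)
    (torsion_add_right hp hΘ hN hc) (torsion_smul_right hp hΘ hN hc)

omit [Module ℝ 𝓔] [IsScalarTower ℝ R 𝓔] in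
/-- A bilinear map `t` for which `⟨t(u, v), w⟩` is totally skew-symmetric defines an alternating
trilinear form. -/
theorem exists_alternatingMap_of_skew (hp : IsPerfectMetric p) (t : 𝓔 →ₗ[R] 𝓔 →ₗ[R] 𝓔)
    (h₁₂ : ∀ u v w, p (t u v) w = -p (t v u) w) (h₂₃ : ∀ u v w, p (t u v) w = -p (t u w) v) :
    ∃ a : 𝓔 [⋀^Fin 3]→ₗ[R] R, ∀ u v w, a ![u, v, w] = p (t u v) w := by
  -- `R` is a real algebra, so 2 is invertible and skew forms are alternating.
  have eq_zero {f : R} (h : f = -f) : f = 0 := by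
    have : (2 : ℝ) • f = 0 := by rw [two_smul]; nth_rw 1 [h]; exact neg_add_cancel f
    simpa using congrArg ((2⁻¹ : ℝ) • ·) this
  refine ⟨{
    toFun := fun m => p (t (m 0) (m 1)) (m 2)
    map_update_add' := ?_
    map_update_smul' := ?_
    map_eq_zero_of_eq' := ?_ }, fun u v w => rfl⟩
  · intro inst m i x y
    obtain rfl : inst = instDecidableEqFin 3 := Subsingleton.elim _ _
    fin_cases i <;> simp [Function.update, hp.add_left, hp.add_right]
  · intro inst m i f x
    obtain rfl : inst = instDecidableEqFin 3 := Subsingleton.elim _ _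
    fin_cases i <;> simp [Function.update, hp.smul_left, hp.smul_right]
  · intro m i j hij hne
    have h : m 0 = m 1 ∨ m 1 = m 2 ∨ m 0 = m 2 := by
      fin_cases i <;> fin_cases j <;>
      first
        | exact absurd rfl hne
        | exact .inl hij
        | exact .inl hij.symm
        | exact .inr (.inl hij)
        | exact .inr (.inl hij.symm)
        | exact .inr (.inr hij)
        | exact .inr (.inr hij.symm)
    have h₀₁ (u w : 𝓔) : p (t u u) w = 0 := eq_zero (h₁₂ u u w)
    rcases h with h | h | h
    · simp only [h, h₀₁]
    · simp only [h, eq_zero (h₂₃ (m 0) (m 2) (m 2))]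
    · simp only [h]
      rw [h₂₃, h₀₁, neg_zero]

/-- A bilinear map `t` for which `⟨t(u, v), w⟩` is totally skew-symmetric defines a function of
degree `3`. -/
theorem isFunction_ofTensor (hp : IsPerfectMetric p) (t : 𝓔 →ₗ[R] 𝓔 →ₗ[R] 𝓔)
    (h₁₂ : ∀ u v w, p (t u v) w = -p (t v u) w) (h₂₃ : ∀ u v w, p (t u v) w = -p (t u w) v) :
    IsFunction p 3 (ofTensor p fun u v => t u v) where
  support := ofTensor_support _ _
  add_section l r u v fs := by
    rcases fs with _ | ⟨f, fs⟩
    · rcases l with _ | ⟨a, _ | ⟨b, _ | ⟨d, l⟩⟩⟩ <;>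
      rcases r with _ | ⟨a', _ | ⟨b', _ | ⟨d', r⟩⟩⟩ <;>
      simp [ofTensor, hp.add_left, hp.add_right]
    · simp [ofTensor]
  smul_section l r a u fs := by
    have hr (a : ℝ) (u v : 𝓔) : t u (a • v) = a • t u v := by
      rw [← algebraMap_smul R a v, map_smul, algebraMap_smul]
    rcases fs with _ | ⟨f, fs⟩
    · rcases l with _ | ⟨a, _ | ⟨b, _ | ⟨d, l⟩⟩⟩ <;>
      rcases r with _ | ⟨a', _ | ⟨b', _ | ⟨d', r⟩⟩⟩ <;>
      simp [ofTensor, hp.real_smul_left, hp.real_smul_right, hr]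
    · simp [ofTensor]
  smul_last l f u fs := by
    rcases fs with _ | ⟨h, fs⟩
    · rcases l with _ | ⟨a, _ | ⟨b, _ | ⟨d, l⟩⟩⟩ <;> simp [ofTensor, hp.smul_right]
    · simp [ofTensor]
  swap l r u v fs := by
    rcases fs with _ | ⟨f, fs⟩
    · rcases l with _ | ⟨a, _ | ⟨b, _ | ⟨d, l⟩⟩⟩ <;>
      rcases r with _ | ⟨a', _ | ⟨b', r⟩⟩ <;>
      simp [ofTensor]
      -- Only the two words of three sections survive, and the right side of `swap` vanishes because
      -- the tensor has no anchor part.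
      · rw [h₁₂, neg_add_cancel]
      · rw [h₂₃, neg_add_cancel]
    · simp [ofTensor]
  perm es fs fs' h := by
    rcases fs with _ | ⟨f, fs⟩
    · rw [h.nil_eq]
    · rcases fs' with _ | ⟨f', fs'⟩
      · exact absurd h.length_eq (by simp)
      · simp [ofTensor]
  add_fun := by simp [ofTensor]
  smul_fun := by simp [ofTensor]
  leibniz := by simp [ofTensor]

/-- `{{Ñ, Θ}, Ñ} + c Θ = -2 T̃` for the torsion `T` of `N` when `N² = c`. -/
theorem ofTensor_torsion_eq (hp : IsPerfectMetric p) (hΘ : IsFunction p 3 Θ)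
    (hN : ∀ u v, p (N u) v = -p u (N v)) (hc : ∀ u, N (N u) = c • u) :
    ofTensor p (torsion p Θ N) = -(1 / 2 : ℝ) •
      (bracket p 3 2 (bracket p 2 3 (ofEndo p N) Θ) (ofEndo p N) + c • Θ) := by
  set Φ : Cochain R 𝓔 := bracket p 2 3 (ofEndo p N) Θ with hΦ
  have hΦ_apply : ∀ u v w, Φ [u, v, w] [] = _ := bracket_ofEndo_apply hp hΘ hN
  have hΦ_anchor : ∀ u f, Φ [u] [f] = _ := bracket_ofEndo_anchor hp hΘ
  -- `{Ñ, Θ}` generates the deformed bracket `[u, v]_N`, the representative needed to bracket with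
  -- `Ñ` again.
  have hD (u v w : 𝓔) : Φ [u, v, w] [] = p (deformedDorfman p Θ N u v) w := by
    simp only [hΦ_apply, deformedDorfman, hp.sub_left, hp.add_left, hN, hΘ.pairing_dorfman hp]
    ring
  have hweight (es : List 𝓔) (fs : List R) (h : es.length + 2 * fs.length ≠ 3) :
      bracket p 3 2 Φ (ofEndo p N) es fs = 0 :=
    bracket_eq_zero_of_weight_ne p 3 2 _ _
      (fun es fs h => bracket_eq_zero_of_weight_ne p 2 3 _ _ (ofEndo_support p N) hΘ.support es fs
        (by omega))
      (ofEndo_support p N) es fs (by omega)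
  funext es fs
  simp only [Pi.smul_apply, Pi.add_apply]
  by_cases h : es.length + 2 * fs.length = 3
  · rcases fs with _ | ⟨f, _ | ⟨f', fs⟩⟩
    · obtain ⟨u, v, w, rfl⟩ := List.length_eq_three.1 (by simpa using h)
      rw [bracket_ofEndo_right_apply hp hD hN]
      simp only [hΦ_apply, ofTensor, pairing_torsion hp hΘ hN hc, map_neg, hc, hΘ.neg₁, hΘ.neg₂,
        hΘ.smul₁, hΘ.smul₂, hΘ.smul₃]
      -- Ordered double insertions count each pair of slots twice and each single slot once, as `N²
      -- = c`: hence `-(1 / 2) (-2 P - 3 c Θ + c Θ) = P + c Θ`.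
      module
    · obtain ⟨u, rfl⟩ := List.length_eq_one_iff.1 (show es.length = 1 by simp at h; omega)
      rw [bracket_ofEndo_right_anchor hp (fun u => by rw [hΦ_anchor, hΘ.anchor_zero_right])]
      -- The anchor part of the double bracket is that of `Θ` at `-N² u = -c u`, which `c Θ`
      -- cancels.
      simp [hΦ_anchor, ofTensor, hc, hΘ.anchor_neg, hΘ.anchor_smul]
    · simp at h; omega
  · rw [ofTensor_support _ _ es fs h, hweight es fs h, hΘ.support es fs h]
    simp

/-- The torsion of a skew-symmetric `N` with `N² = c` as a function of degree `3`. -/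
theorem torsion_isTensor_and_eq_bracket (hp : IsPerfectMetric p) (hΘ : IsFunction p 3 Θ)
    (hN : ∀ u v, p (N u) v = -p u (N v)) (hc : ∀ u, N (N u) = c • u) :
    ((∀ u₁ u₂ v, torsion p Θ N (u₁ + u₂) v = torsion p Θ N u₁ v + torsion p Θ N u₂ v) ∧
      (∀ u v₁ v₂, torsion p Θ N u (v₁ + v₂) = torsion p Θ N u v₁ + torsion p Θ N u v₂) ∧
      (∀ (f : R) u v, torsion p Θ N (f • u) v = f • torsion p Θ N u v) ∧
      (∀ (f : R) u v, torsion p Θ N u (f • v) = f • torsion p Θ N u v) ∧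
      (∀ u v, torsion p Θ N u v = -torsion p Θ N v u) ∧
      (∃ t : 𝓔 [⋀^Fin 3]→ₗ[R] R, ∀ u v w, t ![u, v, w] = p (torsion p Θ N u v) w) ∧
      ofTensor p (torsion p Θ N) ∈ functions p 3) ∧
    (∀ u v, ofSection p (torsion p Θ N u v) =
      bracket p 2 1 (bracket p 1 3 (ofSection p u) (ofTensor p (torsion p Θ N)))
        (ofSection p v)) := by
  let t := torsionₗ hp hΘ hN hc
  have h₁₂ : ∀ u v w, p (t u v) w = -p (t v u) w := pairing_torsion_swap_left hp hΘ hN hc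
  have h₂₃ : ∀ u v w, p (t u v) w = -p (t u w) v := pairing_torsion_swap_right hp hΘ hN hc
  refine ⟨⟨torsion_add_left hp hΘ hN hc, torsion_add_right hp hΘ hN hc,
    torsion_smul_left hp hΘ hN hc, torsion_smul_right hp hΘ hN hc, torsion_swap hp hΘ hN hc,
    exists_alternatingMap_of_skew hp t h₁₂ h₂₃, isFunction_ofTensor hp t h₁₂ h₂₃⟩, fun u v => ?_⟩
  rw [bracket_ofSection_left hp, bracket_ofSection_right hp]
  funext es fs
  rcases es with _ | ⟨w, _ | ⟨w', es⟩⟩ <;> rcases fs with _ | ⟨f, fs⟩ <;> rfl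

end Skew

end PoissonAlgebra

/-! ### Smooth sections of a vector bundle. -/

section Geometry

open Topology Bundle

variable {B : Type*} [NormedAddCommGroup B] [NormedSpace ℝ B]
  {M : Type*} [TopologicalSpace M] [ChartedSpace B M]
  {F : Type*} [NormedAddCommGroup F] [NormedSpace ℝ F]
  {V : M → Type*} [TopologicalSpace (Bundle.TotalSpace F V)]
  [∀ x, TopologicalSpace (V x)] [∀ x, AddCommGroup (V x)] [∀ x, Module ℝ (V x)]
  [FiberBundle F V] [VectorBundle ℝ F V]

@[simp]
theorem smul_section_apply (f : C^∞⟮𝓘(ℝ, B), M; ℝ⟯) (s : Cₛ^∞⟮𝓘(ℝ, B); F, V⟯) (x : M) :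
    (f • s) x = f x • s x := rfl

instance : IsScalarTower ℝ C^∞⟮𝓘(ℝ, B), M; ℝ⟯ Cₛ^∞⟮𝓘(ℝ, B); F, V⟯ where
  smul_assoc a f s := by
    ext x
    exact smul_assoc a (f x) (s x)

theorem sum_section_apply {ι : Type*} (t : Finset ι) (s : ι → Cₛ^∞⟮𝓘(ℝ, B); F, V⟯) (x : M) :
    (∑ i ∈ t, s i) x = ∑ i ∈ t, s i x := by
  rw [← ContMDiffSection.coeAddHom_apply, map_sum, Finset.sum_apply]
  rfl

theorem sum_function_apply {ι : Type*} (t : Finset ι) (f : ι → C^∞⟮𝓘(ℝ, B), M; ℝ⟯) (x : M) :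
    (∑ i ∈ t, f i) x = ∑ i ∈ t, f i x := by
  exact map_sum (ContMDiffMap.evalRingHom (I := 𝓘(ℝ, B)) (n := ∞) x) f t

/-! ### Perfectness of the pairing on sections, via local frames. -/

section Frames

variable [FiniteDimensional ℝ B] [IsManifold 𝓘(ℝ, B) ∞ M] [T2Space M] [FiniteDimensional ℝ F]
  [ContMDiffVectorBundle ∞ F V 𝓘(ℝ, B)]

variable (B F V) in
/-- Around every point there are global sections that form a local frame there, and after
multiplication by a cut-off function every section is a combination of them. -/
theorem exists_global_frame (x₀ : M) :
    ∃ (n : ℕ) (σ : Fin n → Cₛ^∞⟮𝓘(ℝ, B); F, V⟯) (ρ : C^∞⟮𝓘(ℝ, B), M; ℝ⟯),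
      (∀ᶠ x in 𝓝 x₀, ρ x = 1) ∧ LinearIndependent ℝ (fun i => σ i x₀) ∧
      ⊤ ≤ Submodule.span ℝ (Set.range fun i => σ i x₀) ∧
      ∀ s : Cₛ^∞⟮𝓘(ℝ, B); F, V⟯, ∃ c : Fin n → C^∞⟮𝓘(ℝ, B), M; ℝ⟯, ρ • s = ∑ i, c i • σ i := by
  let e := trivializationAt F V x₀
  have hx₀ : x₀ ∈ e.baseSet := FiberBundle.mem_baseSet_trivializationAt' x₀
  let b := Module.finBasis ℝ F
  have hfr := e.isLocalFrameOn_localFrame_baseSet 𝓘(ℝ, B) ∞ b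
  obtain ⟨β, -, hβ⟩ := (SmoothBumpFunction.nhds_basis_tsupport (I := 𝓘(ℝ, B)) x₀).mem_iff.1
    (e.open_baseSet.mem_nhds hx₀)
  let σ (i) : Cₛ^∞⟮𝓘(ℝ, B); F, V⟯ := ⟨(β : M → ℝ) • e.localFrame b i,
    (β.contMDiff.contMDiffOn).smul_section_of_tsupport e.open_baseSet hβ (hfr.contMDiffOn i)⟩
  have hσ (i) (x : M) : σ i x = β x • e.localFrame b i x := rfl
  have hσ₀ (i) : σ i x₀ = e.localFrame b i x₀ := by rw [hσ, β.eq_one, one_smul]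
  -- The cut-off is `β²`: one factor extends the frame by zero, the other extends the coefficients
  -- of `s`.
  refine ⟨_, σ, ⟨fun x => β x * β x, β.contMDiff.mul β.contMDiff⟩, ?_, ?_, ?_, fun s => ?_⟩
  · filter_upwards [β.eventuallyEq_one] with x hx
    change β x * β x = 1
    rw [hx]; simp
  · simp only [hσ₀]
    exact hfr.linearIndependent hx₀
  · simp only [hσ₀]
    exact hfr.generating hx₀
  · have hs (i) : ContMDiffOn 𝓘(ℝ, B) 𝓘(ℝ, ℝ) ∞
        (fun x => e.localFrameCoeff 𝓘(ℝ, B) b i x (s x)) e.baseSet :=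
      contMDiffOn_baseSet_localFrameCoeff b s.contMDiff.contMDiffOn i
    refine ⟨fun i => ⟨fun x => β x • e.localFrameCoeff 𝓘(ℝ, B) b i x (s x), ?_⟩, ?_⟩
    · refine contMDiff_of_tsupport fun x hx => ?_
      have hx' := hβ (tsupport_smul_subset_left _ _ hx)
      exact β.contMDiffAt.smul ((hs i).contMDiffAt (e.open_baseSet.mem_nhds hx'))
    · ext x
      rw [sum_section_apply]
      change (β x * β x) • s x = ∑ i, (β x • e.localFrameCoeff 𝓘(ℝ, B) b i x (s x)) • σ i x
      by_cases hx : x ∈ e.baseSet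
      · conv_lhs => rw [e.eq_sum_localFrameCoeff_smul (I := 𝓘(ℝ, B)) (b := b) (s := s) hx]
        rw [Finset.smul_sum]
        refine Finset.sum_congr rfl fun i _ => ?_
        rw [hσ, smul_smul, smul_smul, smul_eq_mul]
        congr 1
        ring
      · have : β x = 0 := image_eq_zero_of_notMem_tsupport fun h => hx (hβ h)
        simp [this]

/-- Two vectors of a fibre coincide if they pair equally with all global sections. -/
theorem FiberMetric.ext_sections (g : FiberMetric B F V) (x : M) (v v' : V x)
    (h : ∀ w : Cₛ^∞⟮𝓘(ℝ, B); F, V⟯, g.form x v (w x) = g.form x v' (w x)) : v = v' := by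
  obtain ⟨n, σ, ρ, -, -, hspan, -⟩ := exists_global_frame B F V x
  refine sub_eq_zero.1 (g.nondegenerate x _ fun w => ?_)
  have hw : w ∈ Submodule.span ℝ (Set.range fun i => σ i x) := hspan trivial
  rw [map_sub, sub_apply, sub_eq_zero]
  induction hw using Submodule.span_induction with
  | mem _ hw => obtain ⟨i, rfl⟩ := hw; exact h _
  | zero => simp
  | add _ _ _ _ h₁ h₂ => rw [map_add, map_add, h₁, h₂]
  | smul a _ _ h => rw [map_smul, map_smul, h]

/-- Locally, a functional on sections is given, up to the Gram determinant of a frame, by the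
pairing with a section. -/
theorem FiberMetric.exists_local_representative (g : FiberMetric B F V)
    (φ : Cₛ^∞⟮𝓘(ℝ, B); F, V⟯ →ₗ[C^∞⟮𝓘(ℝ, B), M; ℝ⟯] C^∞⟮𝓘(ℝ, B), M; ℝ⟯) (x₀ : M) :
    ∃ (d : C^∞⟮𝓘(ℝ, B), M; ℝ⟯) (s : Cₛ^∞⟮𝓘(ℝ, B); F, V⟯), d x₀ ≠ 0 ∧
      ∀ᶠ x in 𝓝 x₀, ∀ w : Cₛ^∞⟮𝓘(ℝ, B); F, V⟯, g.form x (s x) (w x) = d x * φ w x := by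
  obtain ⟨n, σ, ρ, hρ, hli, hspan, hσ⟩ := exists_global_frame B F V x₀
  let G : Matrix (Fin n) (Fin n) C^∞⟮𝓘(ℝ, B), M; ℝ⟯ := .of fun i j => g.pairing (σ i) (σ j)
  -- Cramer's rule: the adjugate has globally smooth entries, whereas the Gram matrix `G` is
  -- guaranteed to be invertible only near `x₀`.
  let a : Fin n → C^∞⟮𝓘(ℝ, B), M; ℝ⟯ := Matrix.vecMul (fun j => φ (σ j)) G.adjugate
  have ha : Matrix.vecMul a G = G.det • fun j => φ (σ j) := by
    rw [Matrix.vecMul_vecMul, Matrix.adjugate_mul, Matrix.vecMul_smul, Matrix.vecMul_one]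
  let s : Cₛ^∞⟮𝓘(ℝ, B); F, V⟯ := ∑ i, a i • σ i
  refine ⟨G.det, s, fun hdet => ?_, ?_⟩
  · have hdet' : (G.map (ContMDiffMap.evalRingHom (I := 𝓘(ℝ, B)) (n := ∞) x₀)).det = 0 := by
      rw [← RingHom.mapMatrix_apply, ← RingHom.map_det]
      exact hdet
    -- A kernel vector of the Gram matrix would give a combination of the frame at `x₀` orthogonal
    -- to the whole fibre.
    obtain ⟨v, hv, hvG⟩ := Matrix.exists_vecMul_eq_zero_iff.2 hdet'
    refine hv (funext fun i => Fintype.linearIndependent_iff.1 hli v ?_ i)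
    refine g.nondegenerate x₀ _ fun w => ?_
    have hw : w ∈ Submodule.span ℝ (Set.range fun i => σ i x₀) := hspan trivial
    induction hw using Submodule.span_induction with
    | mem _ hw =>
      obtain ⟨j, rfl⟩ := hw
      rw [map_sum, sum_apply]
      have := congrFun hvG j
      simp only [Matrix.vecMul, dotProduct] at this
      simpa using! this
    | zero => simp
    | add _ _ _ _ h₁ h₂ => rw [map_add, h₁, h₂, add_zero]
    | smul c _ _ h => rw [map_smul, h, smul_zero]
  · filter_upwards [hρ] with x hx w
    obtain ⟨c, hc⟩ := hσ w
    have hcx : w x = ∑ j, c j x • σ j x := by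
      simpa [hx, sum_section_apply] using congrArg (fun t : Cₛ^∞⟮𝓘(ℝ, B); F, V⟯ => t x) hc
    have hφ : φ w x = ∑ j, c j x * φ (σ j) x := by
      have := congrArg (fun f : C^∞⟮𝓘(ℝ, B), M; ℝ⟯ => f x) (congrArg φ hc)
      simpa [hx, sum_function_apply] using this
    have hs (j : Fin n) : g.form x (s x) (σ j x) = G.det x * φ (σ j) x := by
      have := congrArg (fun f : C^∞⟮𝓘(ℝ, B), M; ℝ⟯ => f x) (congrFun ha j)
      simp only [s, sum_section_apply, map_sum, sum_apply]
      simp only [Matrix.vecMul, dotProduct, sum_function_apply] at this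
      simpa using! this
    rw [hcx, hφ, map_sum, Finset.mul_sum]
    refine Finset.sum_congr rfl fun j _ => ?_
    rw [map_smul, hs, smul_eq_mul]
    ring

/-- The sections of a bundle with a nondegenerate form are identified with their dual. -/
theorem FiberMetric.isPerfectMetric_pairing (g : FiberMetric B F V) :
    IsPerfectMetric (R := C^∞⟮𝓘(ℝ, B), M; ℝ⟯) (𝓔 := Cₛ^∞⟮𝓘(ℝ, B); F, V⟯) g.pairing where
  add_left u v w := by
    ext x
    change g.form x (u x + v x) (w x) = g.form x (u x) (w x) + g.form x (v x) (w x)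
    simp
  smul_left f u v := by
    ext x
    change g.form x (f x • u x) (v x) = f x * g.form x (u x) (v x)
    simp
  symm u v := by
    ext x
    exact g.symm x _ _
  separating u v h := by
    ext x
    exact g.ext_sections x _ _ fun w => congrArg (fun f : C^∞⟮𝓘(ℝ, B), M; ℝ⟯ => f x) (h w)
  represents φ := by
    choose d s hd hs using g.exists_local_representative φ
    have hx (x : M) (w : Cₛ^∞⟮𝓘(ℝ, B); F, V⟯) :
        g.form x ((d x x)⁻¹ • s x x) (w x) = φ w x := by
      simp [(hs x).self_of_nhds w, hd x]
    -- Each fibre value uses the local data chosen at its own point. Near `x₀` it agrees with the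
    -- smooth `(d x₀)⁻¹ • s x₀`, because both pair with all sections as `φ` does.
    refine ⟨⟨fun x => (d x x)⁻¹ • s x x, fun x₀ => ?_⟩, fun w => ContMDiffMap.ext fun x =>
      (hx x w).symm⟩
    have hd₀ : ∀ᶠ x in 𝓝 x₀, d x₀ x ≠ 0 :=
      (d x₀).contMDiff.continuous.continuousAt.eventually_ne (hd x₀)
    have hinv : ContMDiffAt 𝓘(ℝ, B) 𝓘(ℝ, ℝ) ∞ (fun x => (d x₀ x)⁻¹) x₀ :=
      (d x₀).contMDiff.contMDiffAt.inv₀ (hd x₀)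
    refine (hinv.smul_section (s x₀).contMDiff.contMDiffAt).congr_of_eventuallyEq ?_
    filter_upwards [hd₀, hs x₀] with x hdx hsx
    refine congrArg (TotalSpace.mk' F x) (g.ext_sections x _ _ fun w => ?_)
    rw [hx]
    simp [hsx w, hdx]

end Frames

/-! ### Bundle endomorphisms acting on sections. -/

variable [∀ x, IsTopologicalAddGroup (V x)] [∀ x, ContinuousSMul ℝ (V x)]

/-- The action of a bundle endomorphism on sections, as a map linear over the functions. -/
noncomputable def BundleEndo.onSectionsₗ (N : BundleEndo B F V) :
    Cₛ^∞⟮𝓘(ℝ, B); F, V⟯ →ₗ[C^∞⟮𝓘(ℝ, B), M; ℝ⟯] Cₛ^∞⟮𝓘(ℝ, B); F, V⟯ where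
  toFun := N.onSections
  map_add' u v := by
    ext x
    exact map_add (N.map x) (u x) (v x)
  map_smul' f u := by
    ext x
    exact map_smul (N.map x) (f x) (u x)

theorem BundleEndo.IsSkew.pairing {g : FiberMetric B F V} {N : BundleEndo B F V}
    (hN : N.IsSkew g) (u v : Cₛ^∞⟮𝓘(ℝ, B); F, V⟯) :
    g.pairing (N.onSections u) v = -g.pairing u (N.onSections v) := by
  ext x
  exact eq_neg_of_add_eq_zero_left (hN x (u x) (v x))

theorem BundleEndo.SquareEq.onSections {N : BundleEndo B F V} {c : ℝ} (hN : N.SquareEq c)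
    (u : Cₛ^∞⟮𝓘(ℝ, B); F, V⟯) : N.onSections (N.onSections u) = c • u := by
  ext x
  exact hN x (u x)

theorem BundleEndo.IsProportionalToAlmostCPS.isSkew {g : FiberMetric B F V}
    {N : BundleEndo B F V} (hN : N.IsProportionalToAlmostCPS g) : N.IsSkew g := by
  obtain ⟨κ, J, ⟨hJ, -⟩, hNJ⟩ := hN
  intro x u v
  simp only [hNJ, smul_apply, map_smul, ← smul_add, hJ x u v, smul_zero]

theorem BundleEndo.IsProportionalToAlmostCPS.exists_squareEq {g : FiberMetric B F V}
    {N : BundleEndo B F V} (hN : N.IsProportionalToAlmostCPS g) : ∃ c, N.SquareEq c := by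
  obtain ⟨κ, J, ⟨-, ε, -, hJ⟩, hNJ⟩ := hN
  refine ⟨κ * κ * ε, fun x u => ?_⟩
  simp only [hNJ, smul_apply, map_smul, hJ x u, smul_smul, mul_assoc]

end Geometry

end MinimalRealization

theorem theorem3p1
    {B : Type*} [NormedAddCommGroup B] [NormedSpace ℝ B] [FiniteDimensional ℝ B]
    {M : Type*} [TopologicalSpace M] [ChartedSpace B M] [IsManifold 𝓘(ℝ, B) ∞ M]
    [T2Space M] [SigmaCompactSpace M]
    {F : Type*} [NormedAddCommGroup F] [NormedSpace ℝ F] [FiniteDimensional ℝ F]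
    {V : M → Type*} [TopologicalSpace (Bundle.TotalSpace F V)]
    [∀ x, TopologicalSpace (V x)] [∀ x, AddCommGroup (V x)] [∀ x, Module ℝ (V x)]
    [∀ x, IsTopologicalAddGroup (V x)] [∀ x, ContinuousSMul ℝ (V x)]
    [FiberBundle F V] [VectorBundle ℝ F V] [ContMDiffVectorBundle ∞ F V 𝓘(ℝ, B)]
    (g : MinimalRealization.FiberMetric B F V)
    (Θ : MinimalRealization.Cochain C^∞⟮𝓘(ℝ, B), M; ℝ⟯ Cₛ^∞⟮𝓘(ℝ, B); F, V⟯)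
    (hΘ : MinimalRealization.IsCourantStructure g.pairing Θ)
    (N : MinimalRealization.BundleEndo B F V) (hN : N.IsProportionalToAlmostCPS g) :
    let p := g.pairing
    let T := MinimalRealization.torsion p Θ N.onSections
    let T' := MinimalRealization.ofTensor p T
    let N' := MinimalRealization.ofEndo p N.onSections
    -- (i) the torsion is bilinear over the smooth functions and skew-symmetric,
    ((∀ u₁ u₂ v, T (u₁ + u₂) v = T u₁ v + T u₂ v) ∧
      (∀ u v₁ v₂, T u (v₁ + v₂) = T u v₁ + T u v₂) ∧
      (∀ (f : C^∞⟮𝓘(ℝ, B), M; ℝ⟯) u v, T (f • u) v = f • T u v) ∧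
      (∀ (f : C^∞⟮𝓘(ℝ, B), M; ℝ⟯) u v, T u (f • v) = f • T u v) ∧
      (∀ u v, T u v = -T v u) ∧
      -- it defines a skew-symmetric covariant 3-tensor and an element of degree 3
      (∃ t : Cₛ^∞⟮𝓘(ℝ, B); F, V⟯ [⋀^Fin 3]→ₗ[C^∞⟮𝓘(ℝ, B), M; ℝ⟯] C^∞⟮𝓘(ℝ, B), M; ℝ⟯,
        ∀ u v w, t ![u, v, w] = p (T u v) w) ∧
      T' ∈ MinimalRealization.functions p 3) ∧
    -- (ii)
    (∀ u v, MinimalRealization.ofSection p (T u v) =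
      MinimalRealization.bracket p 2 1
        (MinimalRealization.bracket p 1 3 (MinimalRealization.ofSection p u) T')
        (MinimalRealization.ofSection p v)) ∧
    -- (iii)
    (∀ c : ℝ, N.SquareEq c →
      T' = -(1 / 2 : ℝ) •
        (MinimalRealization.bracket p 3 2 (MinimalRealization.bracket p 2 3 N' Θ) N' + c • Θ)) := by
  have hp := g.isPerfectMetric_pairing
  have hskew : ∀ u v, g.pairing (N.onSectionsₗ u) v = -g.pairing u (N.onSectionsₗ v) :=
    hN.isSkew.pairing
  -- Tensoriality needs only some constant `c₀`. Part (iii) is proved for an arbitrary `c` with `N²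
  -- = c`, which need not equal `c₀` when the bundle has rank zero.
  obtain ⟨c₀, hc₀⟩ := hN.exists_squareEq
  have hsq : ∀ u, N.onSectionsₗ (N.onSectionsₗ u) = c₀ • u := hc₀.onSections
  obtain ⟨h₁, h₂⟩ := MinimalRealization.torsion_isTensor_and_eq_bracket hp hΘ.mem hskew hsq
  refine ⟨h₁, h₂, fun c hc => ?_⟩
  exact MinimalRealization.ofTensor_torsion_eq (N := N.onSectionsₗ) hp hΘ.mem hskew hc.onSections
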